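/- Let $T>0$ and let $X=(X_t)_{t\in[0,T]}$ be a centered separable Gaussian process on a probability space $(\Omega,\mathcal F,\mathbb P)$ with $\sup_{t\in[0,T]}\mathbb E[X_t^2]<\infty$. Assume that there are a kernel $K\in L^2([0,T]^2)$ with $K(t,\cdot)\in L^2([0,T])$ for every $t\in[0,T]$ and a standard Brownian motion $W$ on $[0,T]$ such that, for every $t\in[0,T]$, $X_t=\int_0^T K(t,s)\,dW_s$ almost surely (Wiener integral), and that the closed linear spans in $L^2(\Omega)$ of $\{X_s: s\in[0,T]\}$ and of $\{W_s: s\in[0,T]\}$ coincide. Let $$\Delta=[t_L^1,t_U^1]\cup\dots\cup[t_L^n,t_U^n],\qquad 0\le t_L^1<t_U^1<t_L^2<\dots<t_L^n<t_U^n\le T .$$ Let $f:[0,T]\times\mathbb R\to\mathbb R$ be such that $x\mapsto f(s,x)$ is a Borel measurable bijection of $\mathbb R$ for every $s\in[0,T]$, and put $Y_s=f(s,X_s)$, $\mathcal F_\Delta=\sigma(X_s:s\in\Delta)$, $\mathcal F^Y_\Delta=\sigma(Y_s:s\in\Delta)$. Let $t\in[0,T]\setminus\Delta$ and suppose that $\mathbb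 E|Y_t|<\infty$. Then there is exactly one $f_t\in L^2([0,T])$ such that $$\int_0^T f_t(s)K(u,s)\,ds=\int_0^T K(t,s)K(u,s)\,ds\quad\text{for all }u\in\Delta,$$ and $\int_0^T f_t(s)h(s)\,ds=0$ for every $h\in L^2([0,T])$ with $\int_0^T h(s)K(u,s)\,ds=0$ for all $u\in\Delta$. With $$\hat X_t=\int_0^T f_t(s)\,dW_s,\qquad \rho(t,t|\Delta)=\int_0^T\big(K(t,u)-f_t(u)\big)^2du,$$ and $\phi$ the standard normal density, one has almost surely $\hat X_t=\mathbb E[X_t|\mathcal F_\Delta]$, the function $z\mapsto f\big(t,\hat X_t+z\sqrt{\rho(t,t|\Delta)}\big)\phi(z)$ is integrable on $\mathbb R$, and $$\mathbb E\big[Y_t\,\big|\,\mathcal F^Y_\Delta\big]=\int_{-\infty}^{\infty} f\big(t,\hat X_t+z\sqrt{\rho(t,t|\Delta)}\big)\,\phi(z)\,dz .$$ -/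

import Mathlib

open MeasureTheory ProbabilityTheory Set

noncomputable section

namespace GaussPred

/-- Lebesgue measure on the interval `[0,T]`. -/
abbrev timeMeasure (T : ℝ) : Measure ℝ := volume.restrict (Icc 0 T)

/-- The space `L²([0,T])`. -/
abbrev L2Time (T : ℝ) : Type := Lp ℝ 2 (timeMeasure T)

/-- `W` is a standard Brownian motion on `[0,T]` (only the times in `[0,T]` matter): a centered
Gaussian process with covariance `min s t` and almost surely continuous paths.
In particular `W 0 = 0` almost surely. -/
structure IsBrownianOn {Ω : Type*} [MeasurableSpace Ω] (P : Measure Ω) (T : ℝ)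
    (W : ℝ → Ω → ℝ) : Prop where
  gaussian : IsGaussianProcess (fun t : Icc (0 : ℝ) T => W t) P
  centered : ∀ t ∈ Icc (0 : ℝ) T, ∫ ω, W t ω ∂P = 0
  covariance : ∀ s ∈ Icc (0 : ℝ) T, ∀ t ∈ Icc (0 : ℝ) T, ∫ ω, W s ω * W t ω ∂P = min s t
  continuous_paths : ∀ᵐ ω ∂P, ContinuousOn (fun t => W t ω) (Icc 0 T)

/-- Separability of a process on `[0,T]` in the sense of Doob: there is a countable set `S` of
times such that, outside a null set, every value `X t ω` is a limit point of the values
`X s ω` with `s ∈ S` arbitrarily close to `t`. -/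
def IsSeparableProcess {Ω : Type*} [MeasurableSpace Ω] (P : Measure Ω) (T : ℝ)
    (X : ℝ → Ω → ℝ) : Prop :=
  ∃ S : Set ℝ, S.Countable ∧ S ⊆ Icc 0 T ∧
    ∀ᵐ ω ∂P, ∀ t ∈ Icc (0 : ℝ) T, ∀ ε > 0,
      X t ω ∈ closure ((fun s => X s ω) '' (S ∩ Ioo (t - ε) (t + ε)))

/-- The first chaos `H^X_t`: the closure in `L²(Ω)` of the linear span of `X s`, `s ∈ [0,t]`. -/
def firstChaos {Ω : Type*} [MeasurableSpace Ω] (P : Measure Ω) (X : ℝ → Ω → ℝ) (t : ℝ) :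
    Submodule ℝ (Lp ℝ 2 P) :=
  (Submodule.span ℝ {ξ : Lp ℝ 2 P | ∃ s ∈ Icc (0 : ℝ) t, ξ =ᵐ[P] X s}).topologicalClosure

/-- The graph of the Wiener integral: the closure in `L²([0,T]) × L²(Ω)` of the graph of the
elementary integral of step functions, i.e. of the linear span of the pairs `(1_{(0,t]}, W t)`. -/
def wienerGraph {Ω : Type*} [MeasurableSpace Ω] (P : Measure Ω) (T : ℝ) (W : ℝ → Ω → ℝ) :
    Submodule ℝ (L2Time T × Lp ℝ 2 P) :=
  (Submodule.span ℝ {p : L2Time T × Lp ℝ 2 P | ∃ t ∈ Icc (0 : ℝ) T,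
    p.1 =ᵐ[timeMeasure T] (Ioc 0 t).indicator (fun _ => (1 : ℝ)) ∧
    p.2 =ᵐ[P] W t}).topologicalClosure

/-- The Wiener integral `∫₀ᵀ g(s) dW_s` of `g ∈ L²([0,T])`: the `L²(Ω)`-limit of the elementary
integrals of step functions that converge to `g` in `L²([0,T])`. For a Brownian motion `W` this
limit exists and is unique, see `IsBrownianOn.existsUnique_mem_wienerGraph`. -/
def wienerIntegral {Ω : Type*} [MeasurableSpace Ω] (P : Measure Ω) (T : ℝ) (W : ℝ → Ω → ℝ)
    (g : L2Time T) : Lp ℝ 2 P :=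
  Classical.epsilon fun ξ => (g, ξ) ∈ wienerGraph P T W

section WellDefined

variable {Ω : Type*} [MeasurableSpace Ω] {P : Measure Ω} {T : ℝ} {W : ℝ → Ω → ℝ}

theorem IsBrownianOn.inner_eq (hW : IsBrownianOn P T W)
    {p q : L2Time T × Lp ℝ 2 P}
    (hp : ∃ t ∈ Icc (0 : ℝ) T, p.1 =ᵐ[timeMeasure T] (Ioc 0 t).indicator (fun _ => (1 : ℝ)) ∧
      p.2 =ᵐ[P] W t)
    (hq : ∃ t ∈ Icc (0 : ℝ) T, q.1 =ᵐ[timeMeasure T] (Ioc 0 t).indicator (fun _ => (1 : ℝ)) ∧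
      q.2 =ᵐ[P] W t) :
    inner ℝ p.1 q.1 = inner ℝ p.2 q.2 := by
  obtain ⟨s, hs, hs1, hs2⟩ := hp
  obtain ⟨t, ht, ht1, ht2⟩ := hq
  rw [L2.inner_def, L2.inner_def]
  have e1 : ∫ a, inner ℝ (p.2 a) (q.2 a) ∂P = min t s := by
    rw [← hW.covariance t ht s hs]
    refine integral_congr_ae ?_
    filter_upwards [hs2, ht2] with a h1 h2
    simp [h1, h2]
  have e2 : ∫ a, inner ℝ (p.1 a) (q.1 a) ∂(timeMeasure T) =
      ∫ a, (Ioc 0 (min t s)).indicator (fun _ => (1 : ℝ)) a ∂(timeMeasure T) := by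
    refine integral_congr_ae ?_
    filter_upwards [hs1, ht1] with a h1 h2
    simp only [h1, h2, indicator, mem_Ioc, le_min_iff]
    by_cases h0 : 0 < a <;> by_cases h3 : a ≤ t <;> by_cases h4 : a ≤ s <;> simp [h0, h3, h4]
  rw [e1, e2, integral_indicator measurableSet_Ioc, Measure.restrict_restrict measurableSet_Ioc]
  have : Ioc 0 (min t s) ∩ Icc 0 T = Ioc 0 (min t s) := by
    refine inter_eq_left.2 fun a ha => ⟨ha.1.le, ha.2.trans ((min_le_left _ _).trans ht.2)⟩
  rw [this]
  simp [ht.1, hs.1]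

theorem IsBrownianOn.norm_eq (hW : IsBrownianOn P T W) {p : L2Time T × Lp ℝ 2 P}
    (hp : p ∈ wienerGraph P T W) : ‖p.1‖ = ‖p.2‖ := by
  have key : ∀ p ∈ Submodule.span ℝ {p : L2Time T × Lp ℝ 2 P | ∃ t ∈ Icc (0 : ℝ) T,
      p.1 =ᵐ[timeMeasure T] (Ioc 0 t).indicator (fun _ => (1 : ℝ)) ∧ p.2 =ᵐ[P] W t},
      ‖p.1‖ = ‖p.2‖ := by
    intro p hp
    have : inner ℝ p.1 p.1 = inner ℝ p.2 p.2 := by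
      refine Submodule.span_induction₂
        (p := fun (x y : L2Time T × Lp ℝ 2 P) _ _ => inner ℝ x.1 y.1 = inner ℝ x.2 y.2)
        (fun x y hx hy => hW.inner_eq hx hy) ?_ ?_ ?_ ?_ ?_ ?_ hp hp
      · simp
      · simp
      · intro x y z _ _ _ h1 h2; simp [inner_add_left, h1, h2]
      · intro x y z _ _ _ h1 h2; simp [inner_add_right, h1, h2]
      · intro r x y _ _ h; simp [inner_smul_left, h]
      · intro r x y _ _ h; simp [inner_smul_right, h]
    rw [real_inner_self_eq_norm_sq, real_inner_self_eq_norm_sq] at this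
    exact (sq_eq_sq₀ (norm_nonneg _) (norm_nonneg _)).1 this
  have hcl : IsClosed {p : L2Time T × Lp ℝ 2 P | ‖p.1‖ = ‖p.2‖} :=
    isClosed_eq continuous_fst.norm continuous_snd.norm
  exact closure_minimal (fun p hp => key p hp) hcl hp

theorem dense_steps (T : ℝ) : (Submodule.span ℝ {g : L2Time T | ∃ t ∈ Icc (0 : ℝ) T,
    g =ᵐ[timeMeasure T] (Ioc 0 t).indicator (fun _ => (1 : ℝ))}).topologicalClosure = ⊤ := by
  rw [Submodule.topologicalClosure_eq_top_iff, Submodule.eq_bot_iff]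
  intro h hh
  rw [Submodule.mem_orthogonal] at hh
  have hint : Integrable h (timeMeasure T) := (Lp.memLp h).integrable (by norm_num)
  have h0 : ∀ t ∈ Icc (0 : ℝ) T, ∫ s in Ioc 0 t, h s ∂(timeMeasure T) = 0 := by
    intro t ht
    have hfin : timeMeasure T (Ioc 0 t) ≠ ⊤ := measure_ne_top _ _
    have := hh (indicatorConstLp 2 measurableSet_Ioc hfin (1 : ℝ))
      (Submodule.subset_span ⟨t, ht, indicatorConstLp_coeFn⟩)
    rwa [L2.inner_indicatorConstLp_one] at this
  have h1 : ∀ t : ℝ, ∫ s in Iic t, h s ∂(timeMeasure T) = 0 := by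
    intro t
    rw [Measure.restrict_restrict measurableSet_Iic]
    rcases lt_or_ge (min t T) 0 with hneg | hpos
    · have : Iic t ∩ Icc 0 T = ∅ := by
        ext a
        simp only [mem_inter_iff, mem_Iic, mem_Icc, mem_empty_iff_false, iff_false, not_and]
        intro h1 h2 h3
        exact absurd (h2.trans (le_min h1 h3)) (not_le.2 hneg)
      simp [this]
    · have hm : min t T ∈ Icc (0 : ℝ) T := ⟨hpos, min_le_right _ _⟩
      have e := h0 _ hm
      rw [Measure.restrict_restrict measurableSet_Ioc] at e
      have e1 : Ioc 0 (min t T) ∩ Icc 0 T = Ioc 0 (min t T) :=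
        inter_eq_left.2 fun a ha => ⟨ha.1.le, ha.2.trans (min_le_right _ _)⟩
      have e2 : Iic t ∩ Icc 0 T = Icc 0 (min t T) := by
        ext a
        simp only [mem_inter_iff, mem_Iic, mem_Icc, le_min_iff]
        tauto
      rw [e1] at e
      rw [e2, integral_Icc_eq_integral_Ioc, e]
  have h2 : ∀ s : Set ℝ, MeasurableSet s → ∫ x in s, h x ∂(timeMeasure T) = 0 := by
    have huniv : ∫ x, h x ∂(timeMeasure T) = 0 := by
      have := h1 T
      rw [Measure.restrict_restrict measurableSet_Iic,
        inter_eq_right.2 Icc_subset_Iic_self] at this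
      exact this
    intro s hs
    induction s, hs using MeasurableSpace.induction_on_inter
      (borel_eq_generateFrom_Iic ℝ ▸ BorelSpace.measurable_eq) isPiSystem_Iic with
    | empty => simp
    | basic u hu =>
      obtain ⟨t, rfl⟩ := hu
      exact h1 t
    | compl u hu ih =>
      have := integral_add_compl hu hint
      rw [ih, huniv] at this
      linarith
    | iUnion f hd hf ih =>
      rw [integral_iUnion hf hd hint.integrableOn]
      simp [ih]
  rw [Lp.eq_zero_iff_ae_eq_zero]
  exact hint.ae_eq_zero_of_forall_setIntegral_eq_zero fun s hs _ => h2 s hs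

theorem IsBrownianOn.existsUnique_mem_wienerGraph (hW : IsBrownianOn P T W) (g : L2Time T) :
    ∃! ξ, (g, ξ) ∈ wienerGraph P T W := by
  have huniq : ∀ ξ η : Lp ℝ 2 P, (g, ξ) ∈ wienerGraph P T W → (g, η) ∈ wienerGraph P T W →
      ξ = η := by
    intro ξ η h1 h2
    have := hW.norm_eq (Submodule.sub_mem _ h1 h2)
    simp only [Prod.fst_sub, Prod.snd_sub, sub_self, norm_zero] at this
    exact sub_eq_zero.1 (norm_eq_zero.1 this.symm)
  suffices hex : ∃ ξ, (g, ξ) ∈ wienerGraph P T W by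
    obtain ⟨ξ, hξ⟩ := hex
    exact ⟨ξ, hξ, fun η hη => huniq η ξ hη hξ⟩
  have hgraph : IsClosed (wienerGraph P T W : Set (L2Time T × Lp ℝ 2 P)) :=
    Submodule.isClosed_topologicalClosure _
  let F : wienerGraph P T W →ₗᵢ[ℝ] L2Time T :=
    { toLinearMap := (LinearMap.fst ℝ _ _).comp (wienerGraph P T W).subtype
      norm_map' := fun p => by
        have h := hW.norm_eq p.2
        change ‖p.1.1‖ = ‖p.1‖
        rw [Prod.norm_def, ← h, max_self] }
  have hcomplete : CompleteSpace (wienerGraph P T W) := hgraph.completeSpace_coe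
  have hclosed : IsClosed (LinearMap.range F.toLinearMap : Set (L2Time T)) := by
    have := F.isometry.isClosedEmbedding.isClosed_range
    simpa [LinearMap.coe_range] using this
  have hle : Submodule.span ℝ {g : L2Time T | ∃ t ∈ Icc (0 : ℝ) T,
      g =ᵐ[timeMeasure T] (Ioc 0 t).indicator (fun _ => (1 : ℝ))} ≤
      LinearMap.range F.toLinearMap := by
    rw [Submodule.span_le]
    rintro k ⟨t, ht, hk⟩
    have hmem : MemLp (W t) 2 P :=
      (hW.gaussian.hasGaussianLaw_eval ⟨t, ht⟩).memLp_two
    exact ⟨⟨(k, hmem.toLp), Submodule.le_topologicalClosure _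
      (Submodule.subset_span ⟨t, ht, hk, hmem.coeFn_toLp⟩)⟩, rfl⟩
  have htop := Submodule.topologicalClosure_minimal _ hle hclosed
  rw [dense_steps] at htop
  obtain ⟨p, hp⟩ := htop (Submodule.mem_top : g ∈ ⊤)
  refine ⟨p.1.2, ?_⟩
  have : (g, p.1.2) = p.1 := Prod.ext hp.symm rfl
  rw [this]
  exact p.2

theorem IsBrownianOn.wienerIntegral_spec (hW : IsBrownianOn P T W) (g : L2Time T) :
    (g, wienerIntegral P T W g) ∈ wienerGraph P T W :=
  Classical.epsilon_spec (hW.existsUnique_mem_wienerGraph g).exists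

end WellDefined

/-- The standing assumption on `X` with Brownian motion `W` and kernel `K`: `X` is a centered
separable Gaussian process on `[0,T]` with uniformly bounded variance, `K ∈ L²([0,T]²)` with
`K(t,·) ∈ L²([0,T])` for every `t ∈ [0,T]`, one has `X t = ∫₀ᵀ K(t,s) dW_s` almost surely for
every `t ∈ [0,T]`, and `X` and `W` have the same first chaos over `[0,T]`. -/
structure StandingAssumption {Ω : Type*} [MeasurableSpace Ω] (P : Measure Ω) (T : ℝ)
    (X W : ℝ → Ω → ℝ) (K : ℝ → ℝ → ℝ) : Prop where
  measurable : ∀ t ∈ Icc (0 : ℝ) T, Measurable (X t)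
  gaussian : IsGaussianProcess (fun t : Icc (0 : ℝ) T => X t) P
  centered : ∀ t ∈ Icc (0 : ℝ) T, ∫ ω, X t ω ∂P = 0
  separable : IsSeparableProcess P T X
  bounded_variance : ∃ C : ℝ, ∀ t ∈ Icc (0 : ℝ) T, ∫ ω, X t ω ^ 2 ∂P ≤ C
  brownian : IsBrownianOn P T W
  kernel_memLp : MemLp (Function.uncurry K) 2 ((timeMeasure T).prod (timeMeasure T))
  kernel_section_memLp : ∀ t ∈ Icc (0 : ℝ) T, MemLp (K t) 2 (timeMeasure T)
  representation : ∀ (t : ℝ) (ht : t ∈ Icc (0 : ℝ) T),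
    X t =ᵐ[P] wienerIntegral P T W ((kernel_section_memLp t ht).toLp (K t))
  chaos_eq : firstChaos P X T = firstChaos P W T

/-- The σ-algebra generated by the process `Z` on the set `Δ` of times. -/
abbrev sigmaOn {Ω : Type*} (Z : ℝ → Ω → ℝ) (Δ : Set ℝ) : MeasurableSpace Ω :=
  ⨆ s ∈ Δ, MeasurableSpace.comap (Z s) (inferInstance : MeasurableSpace ℝ)

/-- `g = f_t` solves the system of Fredholm equations for the prediction of `X t` from the
observations on `Δ`, together with the orthogonality condition that singles out one solution. -/
structure IsPredictionKernel (T : ℝ) (K : ℝ → ℝ → ℝ) (Δ : Set ℝ) (t : ℝ) (g : L2Time T) :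
    Prop where
  fredholm : ∀ u ∈ Δ, ∫ s in Icc 0 T, g s * K u s = ∫ s in Icc 0 T, K t s * K u s
  orthogonal : ∀ h : L2Time T, (∀ u ∈ Δ, ∫ s in Icc 0 T, h s * K u s = 0) →
    ∫ s in Icc 0 T, g s * h s = 0

/-- The conditional covariance `ρ(t,s|Δ) = ∫₀ᵀ (K(t,u) - f_t(u)) (K(s,u) - f_s(u)) du`, where
`gt = f_t` and `gs = f_s` are the prediction kernels at the times `t` and `s`. -/
def condCov (T : ℝ) (K : ℝ → ℝ → ℝ) (t s : ℝ) (gt gs : L2Time T) : ℝ :=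
  ∫ u in Icc 0 T, (K t u - gt u) * (K s u - gs u)

end GaussPred

end

/-! The Wiener integral is a linear isometry I from L²([0,T]) to L²(Ω) with I(k_u) = X_u, where k_u
is the class of K(u,·). Let V be the closed span of the k_u, u ∈ Δ. The Fredholm equations say that
k_t - g is orthogonal to V, and the side condition says that g lies in V^⊥⊥ = V. So g is the
orthogonal projection of k_t on V, which gives existence and uniqueness (`isPredictionKernel_iff`).

Now X_t = I(g) + I(k_t - g). The first term is an L²-limit of combinations of the X_u, hence
measurable with respect to the observations up to a null set. The second is orthogonal to every X_u;
all these variables lie in one closed space of centered Gaussian variables, so it is independent of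
the observations, with law N(0, ‖k_t - g‖²), whose variance is ρ(t,t|Δ). Freezing I(g) and
integrating out the residual gives the formula for φ(X_t); it is used with φ = id and φ = f(t,·).
Observing Y instead of X loses nothing, since each f(s,·) is a Borel injection. -/

open Filter
open scoped Topology NNReal

namespace GaussPred

/-! ### Closed spaces of centered Gaussian variables -/

section GaussianSpace

variable {Ω : Type*} [MeasurableSpace Ω] {P : Measure Ω}

/-- The elements of `L²(Ω)` with a centered Gaussian law. -/
def centeredGaussianSet (P : Measure Ω) : Set (Lp ℝ 2 P) :=
  {ξ | P.map ξ = gaussianReal 0 (‖ξ‖₊ ^ 2)}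

/-- Along an a.e. convergent subsequence the characteristic functions converge by dominated
convergence, and the variances converge because they are squared norms. -/
theorem isClosed_centeredGaussianSet [IsProbabilityMeasure P] :
    IsClosed (centeredGaussianSet P) := by
  refine IsSeqClosed.isClosed fun u ξ hu hlim => ?_
  obtain ⟨φ, hφ, hae⟩ := (tendstoInMeasure_of_tendsto_Lp hlim).exists_seq_tendsto_ae
  have hchar : ∀ (η : Lp ℝ 2 P) (s : ℝ),
      charFun (P.map η) s = ∫ ω, Complex.exp (s * η ω * Complex.I) ∂P := by
    intro η s
    rw [charFun_apply_real, integral_map (Lp.aestronglyMeasurable η).aemeasurable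
      (by fun_prop)]
  have : IsProbabilityMeasure (P.map ξ) :=
    Measure.isProbabilityMeasure_map (Lp.aestronglyMeasurable ξ).aemeasurable
  refine Measure.ext_of_charFun (funext fun s => ?_)
  have h1 : Tendsto (fun n => charFun (P.map (u (φ n))) s) atTop (𝓝 (charFun (P.map ξ) s)) := by
    simp only [hchar]
    refine tendsto_integral_of_dominated_convergence (fun _ => 1) (fun n => ?_)
      (integrable_const _) (fun n => ?_) ?_
    · have := (Lp.aestronglyMeasurable (u (φ n))).aemeasurable
      exact (by fun_prop : AEMeasurable _ P).aestronglyMeasurable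
    · refine ae_of_all _ fun ω => ?_
      rw [← Complex.ofReal_mul, Complex.norm_exp_ofReal_mul_I]
    · filter_upwards [hae] with ω hω
      have hc : Continuous fun x : ℝ => Complex.exp (s * x * Complex.I) := by fun_prop
      exact (hc.tendsto _).comp hω
  have h2 : Tendsto (fun n => charFun (P.map (u (φ n))) s) atTop
      (𝓝 (charFun (gaussianReal 0 (‖ξ‖₊ ^ 2)) s)) := by
    have e : ∀ n, charFun (P.map (u (φ n))) s =
        charFun (gaussianReal 0 (‖u (φ n)‖₊ ^ 2)) s := fun n => by rw [hu (φ n)]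
    simp only [e, charFun_gaussianReal]
    have hn : Tendsto (fun n => ‖u (φ n)‖) atTop (𝓝 ‖ξ‖) :=
      (hlim.comp hφ.tendsto_atTop).norm
    have hc : Continuous fun x : ℝ =>
      Complex.exp (s * (0 : ℝ) * Complex.I - (x : ℂ) ^ 2 * s ^ 2 / 2) := by fun_prop
    simpa using! (hc.tendsto _).comp hn
  exact tendsto_nhds_unique h1 h2

theorem mem_centeredGaussianSet {ξ : Lp ℝ 2 P} (h : HasGaussianLaw ξ P)
    (h0 : ∫ ω, ξ ω ∂P = 0) : ξ ∈ centeredGaussianSet P := by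
  change P.map ξ = _
  rw [h.map_eq_gaussianReal, h0, variance_of_integral_eq_zero h.aemeasurable h0]
  congr 1
  have : ∫ ω, ξ ω ^ 2 ∂P = ‖ξ‖ ^ 2 := by
    rw [← real_inner_self_eq_norm_sq, L2.inner_def]
    refine integral_congr_ae (ae_of_all _ fun ω => ?_)
    simp [sq]
  rw [this]
  ext
  simp

theorem integral_eq_zero_of_mem {ξ : Lp ℝ 2 P} (h : ξ ∈ centeredGaussianSet P) :
    ∫ ω, ξ ω ∂P = 0 := by
  have e := integral_map (μ := P) (Lp.aestronglyMeasurable ξ).aemeasurable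
    (f := fun x : ℝ => x) (by fun_prop)
  rw [← e, h]
  exact integral_id_gaussianReal

/-- The span of a centered Gaussian process consists of centered Gaussian variables. -/
theorem span_subset_centeredGaussianSet {ι : Type*} {X : ι → Ω → ℝ}
    (hX : IsGaussianProcess X P) (hX0 : ∀ i, ∫ ω, X i ω ∂P = 0) :
    (Submodule.span ℝ {ξ : Lp ℝ 2 P | ∃ i, ξ =ᵐ[P] X i} : Set (Lp ℝ 2 P)) ⊆
      centeredGaussianSet P := by
  intro ξ hξ
  have key : ∃ c : ι →₀ ℝ, ξ =ᵐ[P] fun ω => c.sum fun i a => a * X i ω := by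
    induction hξ using Submodule.span_induction with
    | mem ξ h =>
      obtain ⟨i, hi⟩ := h
      exact ⟨Finsupp.single i 1, by simpa using! hi⟩
    | zero => exact ⟨0, by simpa using! Lp.coeFn_zero ℝ 2 P⟩
    | add ξ η _ _ h1 h2 =>
      classical
      obtain ⟨c, hc⟩ := h1
      obtain ⟨d, hd⟩ := h2
      refine ⟨c + d, ?_⟩
      filter_upwards [hc, hd, Lp.coeFn_add ξ η] with ω h1 h2 h3
      rw [h3, Pi.add_apply, h1, h2, Finsupp.sum_add_index' (by simp) (by intros; ring)]
    | smul a ξ _ h =>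
      obtain ⟨c, hc⟩ := h
      refine ⟨a • c, ?_⟩
      filter_upwards [hc, Lp.coeFn_smul a ξ] with ω h1 h2
      rw [h2, Pi.smul_apply, h1, Finsupp.sum_smul_index (by simp), Finsupp.smul_sum]
      simp [mul_assoc]
  obtain ⟨c, hc⟩ := key
  have hlaw : HasGaussianLaw (fun ω => c.sum fun i a => a * X i ω) P := by
    have := (hX.hasGaussianLaw c.support).map
      (∑ i : c.support, c i • ContinuousLinearMap.proj (R := ℝ) (φ := fun _ => ℝ) i)
    refine this.congr (ae_of_all _ fun ω => ?_)
    simp [Finsupp.sum, Finset.sum_attach c.support (fun i => c i * X i ω)]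
  refine mem_centeredGaussianSet (hlaw.congr hc.symm) ?_
  rw [integral_congr_ae hc]
  simp only [Finsupp.sum]
  rw [integral_finsetSum _ fun i _ => (hX.hasGaussianLaw_eval i).integrable.const_mul _]
  simp [integral_const_mul, hX0]

/-- The elements of a subspace of centered Gaussian variables form a Gaussian process. -/
theorem isGaussianProcess_of_subset (M : Submodule ℝ (Lp ℝ 2 P))
    (hM : (M : Set (Lp ℝ 2 P)) ⊆ centeredGaussianSet P) :
    IsGaussianProcess (fun (ξ : M) ω => (ξ : Lp ℝ 2 P) ω) P where
  hasGaussianLaw I := by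
    have hmeas : AEMeasurable (fun ω => I.restrict fun ξ : M => (ξ : Lp ℝ 2 P) ω) P :=
      aemeasurable_pi_lambda _ fun ξ => (Lp.aestronglyMeasurable _).aemeasurable
    refine ⟨isGaussian_of_map_eq_gaussianReal fun L => ?_⟩
    classical
    -- The coefficients are the coordinates of `L`, so `L` of the random vector is again an element
    -- of `M`, hence Gaussian.
    set η : M := ∑ i : I, L (Pi.single i 1) • (i : M) with hη
    refine ⟨0, ‖(η : Lp ℝ 2 P)‖₊ ^ 2, ?_⟩
    rw [AEMeasurable.map_map_of_aemeasurable (by fun_prop) hmeas, ← hM η.2]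
    refine Measure.map_congr ?_
    have hcoe : (η : Lp ℝ 2 P) = ∑ i : I, L (Pi.single i 1) • ((i : M) : Lp ℝ 2 P) := by
      simp [hη]
    have h1 := Lp.coeFn_finsetSum Finset.univ
      (fun i : I => L (Pi.single i 1) • ((i : M) : Lp ℝ 2 P))
    have h2 : ∀ᵐ ω ∂P, ∀ i : I, (L (Pi.single i 1) • ((i : M) : Lp ℝ 2 P) : Lp ℝ 2 P) ω =
        L (Pi.single i 1) * ((i : M) : Lp ℝ 2 P) ω :=
      ae_all_iff.2 fun i => Lp.coeFn_smul _ _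
    filter_upwards [h1, h2] with ω h1 h2
    rw [hcoe, h1]
    simp only [Finset.sum_apply, h2, Function.comp_apply]
    have : (I.restrict fun ξ : M => (ξ : Lp ℝ 2 P) ω) =
        ∑ i : I, ((i : M) : Lp ℝ 2 P) ω • (Pi.single i 1 : I → ℝ) := by
      ext j
      simp [Finset.sum_apply, Pi.single_apply]
    rw [this, map_sum]
    simp [mul_comm]

/-- Within a space of centered Gaussian variables, orthogonality implies independence. -/
theorem indepFun_of_inner_eq_zero {κ : Type*} (M : Submodule ℝ (Lp ℝ 2 P))
    (hM : (M : Set (Lp ℝ 2 P)) ⊆ centeredGaussianSet P) {ξ : Lp ℝ 2 P} (hξ : ξ ∈ M)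
    {ζ : κ → Lp ℝ 2 P} (hζ : ∀ k, ζ k ∈ M) {Z : κ → Ω → ℝ} (hZ : ∀ k, Z k =ᵐ[P] ζ k)
    (horth : ∀ k, inner ℝ (ζ k) ξ = 0) :
    IndepFun (fun ω k => Z k ω) ξ P := by
  -- Adjoining `ξ` as one more index makes it jointly Gaussian with all the `Z k`, so that vanishing
  -- covariances suffice for independence.
  have hG : IsGaussianProcess (Sum.elim Z fun _ : Unit => (ξ : Ω → ℝ)) P := by
    have h := (isGaussianProcess_of_subset M hM).comp_right
      (Sum.elim (fun k => ⟨ζ k, hζ k⟩) (fun _ : Unit => ⟨ξ, hξ⟩) : κ ⊕ Unit → M)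
    refine h.congr ?_
    rintro (k | k)
    · exact (hZ k).symm
    · exact EventuallyEq.rfl
  have hmeas : ∀ η : Lp ℝ 2 P, AEMeasurable η P := fun η =>
    (Lp.aestronglyMeasurable η).aemeasurable
  have hind := hG.indepFun_of_covariance_eq_zero (fun k => (hmeas (ζ k)).congr (hZ k).symm)
    (fun _ => hmeas ξ) fun k _ => ?_
  · exact hind.comp measurable_id (measurable_pi_apply ())
  · refine Eq.trans ?_ (horth k)
    rw [covariance, integral_congr_ae (hZ k), integral_eq_zero_of_mem (hM (hζ k)),
      integral_eq_zero_of_mem (hM hξ), L2.inner_def]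
    refine integral_congr_ae ?_
    filter_upwards [hZ k] with ω hω
    simp [hω, mul_comm]

end GaussianSpace

/-! ### Freezing the observed part and integrating out an independent Gaussian -/

section Conditioning

variable {Ω : Type*} [MeasurableSpace Ω] {P : Measure Ω} [IsProbabilityMeasure P]

/-- The conditional expectation of `φ (J + R)` given `Z`, where `J` is a function of `Z` and `R` is
independent of `Z`. -/
theorem condExp_comp_add_of_indepFun {β : Type*} [mβ : MeasurableSpace β] {Z : Ω → β}
    (hZ : Measurable Z) {J R V : Ω → ℝ} (hJ : AEStronglyMeasurable[mβ.comap Z] J P)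
    (hR : AEMeasurable R P) (hind : IndepFun Z R P) (hV : V =ᵐ[P] J + R) {φ : ℝ → ℝ}
    (hφ : Measurable φ) (hint : Integrable (fun ω => φ (V ω)) P) :
    (∀ᵐ ω ∂P, Integrable (fun r => φ (J ω + r)) (P.map R)) ∧
      P[fun ω => φ (V ω) | mβ.comap Z] =ᵐ[P] fun ω => ∫ r, φ (J ω + r) ∂(P.map R) := by
  obtain ⟨J', hJ', hJJ'⟩ := hJ
  -- Doob–Dynkin factorization through `Z`.
  obtain ⟨j, hj, rfl⟩ := hJ'.measurable.exists_eq_measurable_comp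
  have : IsProbabilityMeasure (P.map R) := Measure.isProbabilityMeasure_map hR
  have hVe : (fun ω => φ (V ω)) =ᵐ[P] fun ω => φ (j (Z ω) + R ω) := by
    filter_upwards [hV, hJJ'] with ω h1 h2
    simp [h1, h2]
  have hF : Measurable fun p : β × ℝ => φ (j p.1 + p.2) := by fun_prop
  have hint' := hint.congr hVe
  -- By independence the conditional law of `R` given `Z` is constant.
  have hcd : condDistrib R Z P =ᵐ[P.map Z] Kernel.const β (P.map R) := by
    refine condDistrib_ae_eq_of_measure_eq_compProd Z hR ?_
    rw [Measure.compProd_const]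
    exact (indepFun_iff_map_prod_eq_prod_map_map hZ.aemeasurable hR).1 hind
  have hcd' := ae_of_ae_map hZ.aemeasurable hcd
  constructor
  · have := Integrable.condDistrib_ae (f := fun p : β × ℝ => φ (j p.1 + p.2))
      hZ.aemeasurable hR
      ((integrable_map_measure hF.aestronglyMeasurable (hZ.aemeasurable.prodMk hR)).2 hint')
    filter_upwards [this, hcd', hJJ'] with ω h1 h2 h3
    rw [h2] at h1
    rw [h3]
    exact h1
  · refine (condExp_congr_ae hVe).trans ?_
    have := condExp_prod_ae_eq_integral_condDistrib hZ hR hF.stronglyMeasurable hint'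
    filter_upwards [this, hcd', hJJ'] with ω h1 h2 h3
    rw [h1, h2, h3]
    rfl

/-- Scaling a standard normal also covers `v = 0`, where the law is a Dirac mass without density. -/
theorem map_mul_sqrt_gaussianReal (v : ℝ≥0) :
    (gaussianReal 0 1).map (fun z => z * √(v : ℝ)) = gaussianReal 0 v := by
  rw [gaussianReal_map_mul_const]
  congr 1
  · simp
  · ext
    simp

theorem integrable_gaussianReal_iff {F : ℝ → ℝ} :
    Integrable F (gaussianReal 0 1) ↔ Integrable fun z => F z * gaussianPDFReal 0 1 z := by
  rw [gaussianReal_of_var_ne_zero _ one_ne_zero, integrable_withDensity_iff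
    (measurable_gaussianPDF _ _) (ae_of_all _ fun _ => gaussianPDF_lt_top)]
  simp only [toReal_gaussianPDF]

theorem integral_comp_add_gaussianReal {φ : ℝ → ℝ} (hφ : Measurable φ) (a : ℝ) (v : ℝ≥0) :
    ∫ r, φ (a + r) ∂(gaussianReal 0 v) = ∫ z, φ (a + z * √(v : ℝ)) * gaussianPDFReal 0 1 z := by
  rw [← map_mul_sqrt_gaussianReal, integral_map (by fun_prop)
    (by fun_prop : Measurable fun r => φ (a + r)).aestronglyMeasurable,
    integral_gaussianReal_eq_integral_smul one_ne_zero]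
  simp [mul_comm]

theorem integrable_comp_add_gaussianReal {φ : ℝ → ℝ} (hφ : Measurable φ) {a : ℝ} {v : ℝ≥0}
    (h : Integrable (fun r => φ (a + r)) (gaussianReal 0 v)) :
    Integrable fun z => φ (a + z * √(v : ℝ)) * gaussianPDFReal 0 1 z := by
  rw [← map_mul_sqrt_gaussianReal, integrable_map_measure
    (by fun_prop : Measurable fun r => φ (a + r)).aestronglyMeasurable (by fun_prop)] at h
  exact integrable_gaussianReal_iff.1 h

end Conditioning

/-! ### Prediction kernels as orthogonal projections, and the prediction formula -/

section Prediction

variable {Ω : Type*} [MeasurableSpace Ω] {P : Measure Ω} {T : ℝ}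

/-- The Wiener integral with respect to a Brownian motion as a linear isometry. -/
noncomputable def IsBrownianOn.wienerIsometry {W : ℝ → Ω → ℝ} (hW : IsBrownianOn P T W) :
    L2Time T →ₗᵢ[ℝ] Lp ℝ 2 P where
  toFun := wienerIntegral P T W
  map_add' g h := (hW.existsUnique_mem_wienerGraph (g + h)).unique
    (hW.wienerIntegral_spec (g + h))
    ((wienerGraph P T W).add_mem (hW.wienerIntegral_spec g) (hW.wienerIntegral_spec h))
  map_smul' c g := (hW.existsUnique_mem_wienerGraph (c • g)).unique
    (hW.wienerIntegral_spec (c • g))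
    ((wienerGraph P T W).smul_mem c (hW.wienerIntegral_spec g))
  norm_map' g := (hW.norm_eq (hW.wienerIntegral_spec g)).symm

theorem IsBrownianOn.wienerIsometry_apply {W : ℝ → Ω → ℝ} (hW : IsBrownianOn P T W)
    (g : L2Time T) : hW.wienerIsometry g = wienerIntegral P T W g := rfl

theorem inner_eq_setIntegral (g : L2Time T) {h : L2Time T} {k : ℝ → ℝ}
    (hk : h =ᵐ[timeMeasure T] k) : inner ℝ h g = ∫ s in Icc 0 T, g s * k s := by
  rw [L2.inner_def]
  refine integral_congr_ae ?_
  filter_upwards [hk] with s hs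
  simp [hs]

/-- The integrals are inner products with the `k u`: the Fredholm equations express orthogonality of
the residual, and the side condition is membership in the double orthogonal complement. -/
theorem isPredictionKernel_iff {K : ℝ → ℝ → ℝ} {Δ : Set ℝ} {t : ℝ} {k : ℝ → L2Time T}
    (hk : ∀ u ∈ insert t Δ, k u =ᵐ[timeMeasure T] K u) (g : L2Time T) :
    IsPredictionKernel T K Δ t g ↔
      g ∈ (Submodule.span ℝ (k '' Δ)).topologicalClosure ∧
        k t - g ∈ (Submodule.span ℝ (k '' Δ))ᗮ := by
  have hperp : ∀ h : L2Time T, h ∈ (Submodule.span ℝ (k '' Δ))ᗮ ↔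
      ∀ u ∈ Δ, inner ℝ (k u) h = 0 := by
    intro h
    rw [Submodule.mem_orthogonal]
    refine ⟨fun H u hu => H _ (Submodule.subset_span ⟨u, hu, rfl⟩), fun H x hx => ?_⟩
    induction hx using Submodule.span_induction with
    | mem x h =>
      obtain ⟨u, hu, rfl⟩ := h
      exact H u hu
    | zero => simp
    | add x y _ _ h1 h2 => rw [inner_add_left, h1, h2, add_zero]
    | smul a x _ h => rw [inner_smul_left, h, mul_zero]
  have hK : ∀ u ∈ Δ, inner ℝ (k u) (k t - g) =
      (∫ s in Icc 0 T, K t s * K u s) - ∫ s in Icc 0 T, g s * K u s := by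
    intro u hu
    rw [inner_sub_right, inner_eq_setIntegral g (hk u (mem_insert_of_mem _ hu)),
      inner_eq_setIntegral (k t) (hk u (mem_insert_of_mem _ hu))]
    congr 1
    refine integral_congr_ae ?_
    filter_upwards [hk t (mem_insert _ _)] with s hs
    rw [hs]
  rw [← Submodule.orthogonal_orthogonal_eq_closure, Submodule.mem_orthogonal, hperp]
  constructor
  · refine fun H => ⟨fun h hh => ?_, fun u hu => ?_⟩
    · rw [inner_eq_setIntegral g EventuallyEq.rfl]
      refine H.orthogonal h fun u hu => ?_
      rw [← inner_eq_setIntegral h (hk u (mem_insert_of_mem _ hu))]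
      exact (hperp h).1 hh u hu
    · rw [hK u hu, H.fredholm u hu, sub_self]
  · refine fun H => ⟨fun u hu => ?_, fun h hh => ?_⟩
    · have := H.2 u hu
      rw [hK u hu] at this
      linarith
    · rw [← inner_eq_setIntegral g EventuallyEq.rfl]
      refine H.1 h ((hperp h).2 fun u hu => ?_)
      rw [inner_eq_setIntegral h (hk u (mem_insert_of_mem _ hu))]
      exact hh u hu

theorem existsUnique_isPredictionKernel {K : ℝ → ℝ → ℝ} {Δ : Set ℝ} {t : ℝ} {k : ℝ → L2Time T}
    (hk : ∀ u ∈ insert t Δ, k u =ᵐ[timeMeasure T] K u) :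
    ∃! g : L2Time T, IsPredictionKernel T K Δ t g := by
  simp only [isPredictionKernel_iff hk]
  set V := Submodule.span ℝ (k '' Δ)
  have hcl : CompleteSpace V.topologicalClosure :=
    V.isClosed_topologicalClosure.completeSpace_coe
  rw [← Submodule.orthogonal_closure V]
  refine ⟨V.topologicalClosure.starProjection (k t), ⟨by simp, V.topologicalClosure.sub_starProjection_mem_orthogonal _⟩, fun g hg => ?_⟩
  exact (Submodule.eq_starProjection_of_mem_orthogonal hg.1 hg.2).symm

theorem condCov_self {K : ℝ → ℝ → ℝ} {t : ℝ} {k g : L2Time T}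
    (hk : k =ᵐ[timeMeasure T] K t) : condCov T K t t g g = ‖k - g‖ ^ 2 := by
  rw [← real_inner_self_eq_norm_sq, L2.inner_def]
  refine integral_congr_ae ?_
  filter_upwards [hk, Lp.coeFn_sub k g] with s h1 h2
  rw [h2, Pi.sub_apply, h1]
  simp [sq]

omit [MeasurableSpace Ω] in
theorem sigmaOn_eq_comap (Z : ℝ → Ω → ℝ) (Δ : Set ℝ) :
    sigmaOn Z Δ = MeasurableSpace.comap (fun ω (u : Δ) => Z u ω) MeasurableSpace.pi := by
  rw [MeasurableSpace.pi, MeasurableSpace.comap_iSup]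
  simp only [MeasurableSpace.comap_comp, sigmaOn, iSup_subtype']
  rfl

-- A Borel injection of ℝ is a measurable embedding (Lusin–Souslin), so it pulls the Borel σ-algebra
-- back to all of it.
omit [MeasurableSpace Ω] in
theorem sigmaOn_congr_of_injective {X Y : ℝ → Ω → ℝ} {f : ℝ → ℝ → ℝ} {Δ : Set ℝ}
    (hf : ∀ s ∈ Δ, Measurable (f s)) (hinj : ∀ s ∈ Δ, Function.Injective (f s))
    (hY : ∀ s ∈ Δ, ∀ ω, Y s ω = f s (X s ω)) : sigmaOn Y Δ = sigmaOn X Δ := by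
  refine biSup_congr fun s hs => ?_
  have : Y s = f s ∘ X s := funext (hY s hs)
  rw [this, ← MeasurableSpace.comap_comp, ((hf s hs).measurableEmbedding (hinj s hs)).comap_eq]

/-- The prediction formula for a measurable function of `X t`: given the observations on `Δ`, the
variable `X t` is Gaussian with mean the Wiener integral of the prediction kernel and variance the
conditional covariance. -/
theorem StandingAssumption.condExp_comp [IsProbabilityMeasure P] {X W : ℝ → Ω → ℝ}
    {K : ℝ → ℝ → ℝ} (hX : StandingAssumption P T X W K) {Δ : Set ℝ} (hΔ : Δ ⊆ Icc 0 T)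
    {t : ℝ} (ht : t ∈ Icc (0 : ℝ) T) {g : L2Time T} (hg : IsPredictionKernel T K Δ t g)
    {φ : ℝ → ℝ} (hφ : Measurable φ) (hint : Integrable (fun ω => φ (X t ω)) P) :
    (∀ᵐ ω ∂P, Integrable (fun z : ℝ => φ (wienerIntegral P T W g ω +
        z * √(condCov T K t t g g)) * gaussianPDFReal 0 1 z)) ∧
      P[fun ω => φ (X t ω) | sigmaOn X Δ] =ᵐ[P] fun ω => ∫ z : ℝ,
        φ (wienerIntegral P T W g ω + z * √(condCov T K t t g g)) * gaussianPDFReal 0 1 z := by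
  have hK : ∀ u ∈ Icc (0 : ℝ) T, ∃ k : L2Time T, k =ᵐ[timeMeasure T] K u ∧
      X u =ᵐ[P] wienerIntegral P T W k := fun u hu =>
    ⟨_, (hX.kernel_section_memLp u hu).coeFn_toLp, hX.representation u hu⟩
  choose! k hk hXk using hK
  have hk' : ∀ u ∈ insert t Δ, k u =ᵐ[timeMeasure T] K u := by
    rintro u (rfl | hu)
    · exact hk _ ht
    · exact hk u (hΔ hu)
  obtain ⟨hg1, hg2⟩ := (isPredictionKernel_iff hk' g).1 hg
  set I := hX.brownian.wienerIsometry with hI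
  simp only [← hX.brownian.wienerIsometry_apply] at hXk ⊢
  -- Used twice: for the subspace of observable variables, and for the Gaussian space `M` below.
  have hclosed_le : ∀ M : Submodule ℝ (Lp ℝ 2 P), IsClosed (M : Set (Lp ℝ 2 P)) →
      (∀ u ∈ Δ, I (k u) ∈ M) → I g ∈ M := by
    intro M hM hu
    have : (Submodule.span ℝ (k '' Δ)).topologicalClosure ≤ M.comap I.toLinearMap := by
      refine Submodule.topologicalClosure_minimal _ (Submodule.span_le.2 ?_)
        (hM.preimage I.continuous)
      rintro _ ⟨u, huΔ, rfl⟩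
      exact hu u huΔ
    exact this hg1
  have hm : sigmaOn X Δ ≤ ‹MeasurableSpace Ω› :=
    iSup₂_le fun u hu => (hX.measurable u (hΔ hu)).comap_le
  have hJ : AEStronglyMeasurable[sigmaOn X Δ] (I g) P := by
    refine mem_lpMeas_iff_aestronglyMeasurable.1
      (hclosed_le (lpMeas ℝ ℝ (sigmaOn X Δ) 2 P) ?_ fun u hu => ?_)
    · exact isClosed_aestronglyMeasurable hm
    · refine mem_lpMeas_iff_aestronglyMeasurable.2 ⟨X u, ?_, (hXk u (hΔ hu)).symm⟩
      exact Measurable.stronglyMeasurable (Measurable.mono (comap_measurable (X u))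
        (le_iSup₂_of_le u hu le_rfl) le_rfl)
  -- The span runs over all of [0,T], not only Δ, so that it also contains X_t and the residual.
  set M : Submodule ℝ (Lp ℝ 2 P) := (Submodule.span ℝ
    {ξ : Lp ℝ 2 P | ∃ u : Icc (0 : ℝ) T, ξ =ᵐ[P] X u}).topologicalClosure with hM
  have hMG : (M : Set (Lp ℝ 2 P)) ⊆ centeredGaussianSet P :=
    closure_minimal (span_subset_centeredGaussianSet hX.gaussian fun u => hX.centered u u.2)
      isClosed_centeredGaussianSet
  have hkM : ∀ u ∈ Icc (0 : ℝ) T, I (k u) ∈ M := fun u hu =>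
    Submodule.le_topologicalClosure _ (Submodule.subset_span ⟨⟨u, hu⟩, (hXk u hu).symm⟩)
  have hgM : I g ∈ M := hclosed_le M (Submodule.isClosed_topologicalClosure _)
    fun u hu => hkM u (hΔ hu)
  have hRM : I (k t - g) ∈ M := by
    rw [map_sub]
    exact M.sub_mem (hkM t ht) hgM
  have hind : IndepFun (fun ω (u : Δ) => X u ω) (I (k t - g)) P := by
    refine indepFun_of_inner_eq_zero M hMG hRM (ζ := fun u : Δ => I (k u))
      (fun u => hkM u (hΔ u.2)) (fun u => hXk u (hΔ u.2)) fun u => ?_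
    rw [I.inner_map_map]
    exact hg2 _ (Submodule.subset_span ⟨u, u.2, rfl⟩)
  have hlaw : P.map (I (k t - g)) = gaussianReal 0 (‖k t - g‖₊ ^ 2) := by
    rw [hMG hRM, I.nnnorm_map]
  have hcov : condCov T K t t g g = ((‖k t - g‖₊ ^ 2 : ℝ≥0) : ℝ) := by
    rw [condCov_self (hk t ht)]
    simp
  have hV : X t =ᵐ[P] ⇑(I g) + ⇑(I (k t - g)) := by
    have : I (k t) = I g + I (k t - g) := by simp
    filter_upwards [hXk t ht, Lp.coeFn_add (I g) (I (k t - g))] with ω h1 h2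
    rw [h1, this, h2]
  rw [sigmaOn_eq_comap] at hJ ⊢
  obtain ⟨h1, h2⟩ := condExp_comp_add_of_indepFun
    (measurable_pi_lambda _ fun u : Δ => hX.measurable u (hΔ u.2)) hJ
    (Lp.aestronglyMeasurable _).aemeasurable hind hV hφ hint
  simp only [hlaw] at h1 h2
  simp only [hcov]
  refine ⟨h1.mono fun ω h => integrable_comp_add_gaussianReal hφ h, h2.trans ?_⟩
  exact ae_of_all _ fun ω => integral_comp_add_gaussianReal hφ _ _

theorem StandingAssumption.condExp_eq_wienerIntegral [IsProbabilityMeasure P] {X W : ℝ → Ω → ℝ}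
    {K : ℝ → ℝ → ℝ} (hX : StandingAssumption P T X W K) {Δ : Set ℝ} (hΔ : Δ ⊆ Icc 0 T)
    {t : ℝ} (ht : t ∈ Icc (0 : ℝ) T) {g : L2Time T} (hg : IsPredictionKernel T K Δ t g) :
    P[X t | sigmaOn X Δ] =ᵐ[P] wienerIntegral P T W g := by
  -- With the variance in `ℝ≥0`, the normal-density integral turns back into the mean of a Gaussian
  -- shifted by the Wiener integral.
  obtain ⟨v, hv⟩ : ∃ v : ℝ≥0, (v : ℝ) = condCov T K t t g g :=
    ⟨_, Real.coe_toNNReal _ (integral_nonneg fun u => mul_self_nonneg _)⟩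
  refine (hX.condExp_comp hΔ ht hg measurable_id
    (hX.gaussian.hasGaussianLaw_eval ⟨t, ht⟩).integrable).2.trans (ae_of_all _ fun ω => ?_)
  simp only [← hv]
  rw [← integral_comp_add_gaussianReal measurable_id]
  simp only [id]
  rw [integral_add (integrable_const _) IsGaussian.integrable_fun_id, integral_id_gaussianReal]
  simp

end Prediction

end GaussPred

theorem mainTheorem7 {Ω : Type*} [MeasurableSpace Ω] (P : Measure Ω) [IsProbabilityMeasure P]
    (T : ℝ) (hT : 0 < T) (X W : ℝ → Ω → ℝ) (K : ℝ → ℝ → ℝ)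
    (hX : GaussPred.StandingAssumption P T X W K)
    (n : ℕ) (tL tU : Fin n → ℝ) (hLU : ∀ k, tL k < tU k) (hUL : ∀ k l, k < l → tU k < tL l)
    (hL : ∀ k, 0 ≤ tL k) (hU : ∀ k, tU k ≤ T)
    (Δ : Set ℝ) (hΔ : Δ = ⋃ k, Icc (tL k) (tU k))
    (f : ℝ → ℝ → ℝ) (hf_meas : ∀ s ∈ Icc (0 : ℝ) T, Measurable (f s))
    (hf_bij : ∀ s ∈ Icc (0 : ℝ) T, Function.Bijective (f s))
    (Y : ℝ → Ω → ℝ) (hY : ∀ s ∈ Icc (0 : ℝ) T, ∀ ω, Y s ω = f s (X s ω))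
    (t : ℝ) (ht : t ∈ Icc (0 : ℝ) T \ Δ) (hY_int : Integrable (Y t) P) :
    (∃! g : GaussPred.L2Time T, GaussPred.IsPredictionKernel T K Δ t g) ∧
    ∀ g : GaussPred.L2Time T, GaussPred.IsPredictionKernel T K Δ t g →
      P[X t | GaussPred.sigmaOn X Δ] =ᵐ[P] GaussPred.wienerIntegral P T W g ∧
      (∀ᵐ ω ∂P, Integrable (fun z : ℝ =>
        f t (GaussPred.wienerIntegral P T W g ω + z * √(GaussPred.condCov T K t t g g)) *
          gaussianPDFReal 0 1 z)) ∧
      P[Y t | GaussPred.sigmaOn Y Δ] =ᵐ[P] fun ω => ∫ z : ℝ,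
        f t (GaussPred.wienerIntegral P T W g ω + z * √(GaussPred.condCov T K t t g g)) *
          gaussianPDFReal 0 1 z := by
  have hsub : Δ ⊆ Icc 0 T := by
    rw [hΔ]
    exact iUnion_subset fun k => Icc_subset_Icc (hL k) (hU k)
  have hK : ∀ u ∈ Icc (0 : ℝ) T, ∃ k : GaussPred.L2Time T,
      k =ᵐ[GaussPred.timeMeasure T] K u := fun u hu =>
    ⟨_, (hX.kernel_section_memLp u hu).coeFn_toLp⟩
  choose! k hk using hK
  refine ⟨GaussPred.existsUnique_isPredictionKernel (k := k) fun u hu =>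
    hk u (insert_subset ht.1 hsub hu), fun g hg =>
    ⟨hX.condExp_eq_wienerIntegral hsub ht.1 hg, ?_⟩⟩
  have hYt : Y t = fun ω => f t (X t ω) := funext (hY t ht.1)
  rw [GaussPred.sigmaOn_congr_of_injective (fun s hs => hf_meas s (hsub hs))
    (fun s hs => (hf_bij s (hsub hs)).1) fun s hs => hY s (hsub hs), hYt]
  rw [hYt] at hY_int
  exact hX.condExp_comp hsub ht.1 hg (hf_meas t ht.1) hY_int
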